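/- Let $n\ge 1$ and let $\mathcal{C}_n$ be the half-cylinder with $n$ marked points, i.e. the annulus with $n$ marked points on one of its boundary components. The marked points of its universal cover $\overline{\mathcal{C}}_n$ are identified with $\mathbb{Z}$, the deck transformations being the translations by multiples of $n$. An edge $[u,v]$ of $\overline{\mathcal{C}}_n$ is the isotopy class of curves joining two distinct marked points $u,v\in\mathbb{Z}$, and its length is $|v-u|$. Two edges $[a,b]$ and $[c,d]$ with $a<b$ and $c<d$ intersect if $a<c<b<d$ or $c<a<d<b$. An $m$-crossing is a set of $m$ pairwise intersecting edges. A $2$-star of $\overline{\mathcal{C}}_n$ is given by five vertices $z_0<z_1<z_2<z_3<z_4$ and has the five edges $[z_i,z_{i+2}]$, with indices modulo $5$. The edges and the $2$-stars of $\mathcal{C}_n$ are the projections of those of $\overline{\mathcal{C}}_n$, i.e. their classes under translation by multiples of $n$; an edge of $\mathcal{C}_n$ has the length of its lifts, and it is $2$-relevant if its length $\ell$ satisfies $2<\ell\le 2n$. A $2$-triangulation on $\mathcal{C}_n$ is an inclusion-maximal set $T$ of edges of $\mathcal{C}_n$ whose full preimage in $\overline{\mathcal{C}}_n$ contains no $3$-crossing;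 it contains a $2$-star if it contains all edges of that star. Then every $2$-triangulation on $\mathcal{C}_n$ contains exactly $n-1$ $2$-stars, exactly $2(n-1)$ $2$-relevant edges, and exactly $2(2n-1)$ edges in total. -/

import Mathlib

/-!
The half-cylinder `C_n` is an annulus with `n` marked points on one boundary component. Its universal
cover is a half-plane whose marked points, on the boundary line, are indexed by `ℤ`; the deck
transformations are the translations by the multiples of `n`.
-/

namespace HalfCylinder

/-- An edge `[u, v]` of the universal cover: the isotopy class of curves joining two distinct marked
points, recorded by its two endpoints in increasing order. -/
@[ext]
structure CoverEdge where
  lo : ℤ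
  hi : ℤ
  lo_lt_hi : lo < hi

namespace CoverEdge

/-- The edge `e` joins the marked points `u` and `v`, i.e. `e = [u, v]`. -/
def Joins (e : CoverEdge) (u v : ℤ) : Prop :=
  (e.lo = u ∧ e.hi = v) ∨ (e.lo = v ∧ e.hi = u)

/-- The length `|v - u|` of the edge `[u, v]`. -/
def length (e : CoverEdge) : ℤ := e.hi - e.lo

/-- The translate `e + t`. -/
def shift (e : CoverEdge) (t : ℤ) : CoverEdge :=
  ⟨e.lo + t, e.hi + t, add_lt_add_left e.lo_lt_hi t⟩

/-- Two edges intersect: their endpoints are distinct and alternate. -/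
def Crosses (e f : CoverEdge) : Prop :=
  (e.lo < f.lo ∧ f.lo < e.hi ∧ e.hi < f.hi) ∨ (f.lo < e.lo ∧ e.lo < f.hi ∧ f.hi < e.hi)

/-- Two edges of the cover are identified when one is a translation of the other by a multiple
of `n`. -/
def translationSetoid (n : ℕ) : Setoid CoverEdge where
  r e f := ∃ l : ℤ, f = e.shift (l * n)
  iseqv :=
    { refl := fun e => ⟨0, by ext <;> simp [shift]⟩
      symm := by
        rintro e f ⟨l, rfl⟩
        exact ⟨-l, by ext <;> simp [shift]⟩
      trans := by
        rintro e f g ⟨l, rfl⟩ ⟨m, rfl⟩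
        exact ⟨l + m, by ext <;> simp only [shift] <;> ring⟩ }

end CoverEdge

/-- A set `E` of edges of the cover is an `m`-crossing: `m` edges that pairwise intersect. -/
def IsCrossing (m : ℕ) (E : Finset CoverEdge) : Prop :=
  E.card = m ∧ (E : Set CoverEdge).Pairwise CoverEdge.Crosses

/-- A set of edges of the cover contains no `m`-crossing. -/
def CrossingFree (m : ℕ) (A : Set CoverEdge) : Prop :=
  ∀ E : Finset CoverEdge, (E : Set CoverEdge) ⊆ A → ¬ IsCrossing m E

/-- The edges of `C_n`: translation classes of edges of the universal cover. -/
def Edge (n : ℕ) : Type := Quotient (CoverEdge.translationSetoid n)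

/-- The covering map on edges. -/
def projEdge (n : ℕ) (e : CoverEdge) : Edge n :=
  Quotient.mk (CoverEdge.translationSetoid n) e

/-- The length of an edge of `C_n` is the length of any of its lifts. -/
def Edge.length {n : ℕ} (c : Edge n) : ℤ :=
  Quotient.lift CoverEdge.length
    (by rintro e f ⟨l, rfl⟩; simp [CoverEdge.length, CoverEdge.shift]) c

/-- An edge of `C_n` is `k`-relevant if its length `ℓ` satisfies `k < ℓ ≤ k n`. -/
def Edge.IsRelevant {n : ℕ} (k : ℕ) (c : Edge n) : Prop :=
  (k : ℤ) < c.length ∧ c.length ≤ (k : ℤ) * n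

/-- A `k`-triangulation on `C_n`: a maximal set of edges whose lift to the universal cover contains no
`(k + 1)`-crossing. -/
def IsTriangulation (n k : ℕ) (T : Set (Edge n)) : Prop :=
  Maximal (fun A : Set (Edge n) => CrossingFree (k + 1) (projEdge n ⁻¹' A)) T

/-- A `k`-star of the universal cover, given by its `2k + 1` vertices `z_0 < z_1 < ⋯ < z_{2k}`.
(Listing the vertices in cyclic order from another starting vertex gives the same star.) -/
@[ext]
structure CoverStar (k : ℕ) where
  z : Fin (2 * k + 1) → ℤ
  strictMono : StrictMono z

namespace CoverStar

/-- The edges `[z_i, z_{i+k}]` of a `k`-star, with indices modulo `2k + 1`. -/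
def edges {k : ℕ} (S : CoverStar k) : Set CoverEdge :=
  {e | ∃ i : Fin (2 * k + 1), e.Joins (S.z i) (S.z (Fin.ofNat (2 * k + 1) (i + k)))}

/-- The translate `S + t`. -/
def shift {k : ℕ} (S : CoverStar k) (t : ℤ) : CoverStar k :=
  ⟨fun i => S.z i + t, fun _ _ h => add_lt_add_left (S.strictMono h) t⟩

/-- Two stars of the cover are identified when one is a translation of the other by a multiple
of `n`. -/
def translationSetoid (n k : ℕ) : Setoid (CoverStar k) where
  r S R := ∃ l : ℤ, R = S.shift (l * n)
  iseqv :=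
    { refl := fun S => ⟨0, by ext; simp [shift]⟩
      symm := by
        rintro S R ⟨l, rfl⟩
        exact ⟨-l, by ext; simp [shift]⟩
      trans := by
        rintro S R Q ⟨l, rfl⟩ ⟨m, rfl⟩
        exact ⟨l + m, by ext; simp only [shift]; ring⟩ }

end CoverStar

/-- The `k`-stars of `C_n`: projections of `k`-stars of the universal cover, two of which have the same
projection when they are translations of each other. -/
def Star (n k : ℕ) : Type := Quotient (CoverStar.translationSetoid n k)

/-- The projection of a `k`-star of the universal cover. -/
def projStar (n : ℕ) {k : ℕ} (S : CoverStar k) : Star n k :=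
  Quotient.mk (CoverStar.translationSetoid n k) S

/-- The edges of a `k`-star of `C_n` are the projections of the edges of its lifts. -/
def Star.edges {n k : ℕ} (s : Star n k) : Set (Edge n) :=
  {c | ∃ S : CoverStar k, projStar n S = s ∧ ∃ e ∈ S.edges, projEdge n e = c}

end HalfCylinder


/-!
Every edge `[p, q]` of the lift of a `2`-triangulation `T` of length more than `2` is an upper
side, `[z₀, z₃]` or `[z₁, z₄]`, of exactly one `2`-star of the lift, and every edge of length at
least `2` other than those of maximal length `2 n` is a lower side, `[z₀, z₂]`, `[z₁, z₃]` or
`[z₂, z₄]`, of exactly one `2`-star of the lift. All edges of length `1` and `2` are in `T`, and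
`T` has exactly one edge of length `2 n`. With `s` stars in `T`, counting the edges of length at
least `2` in two ways gives `2 s + n = 3 s + 1`, hence `s = n - 1`.

An angle of `T` at `u`, between two consecutive neighbours `w` and `v` of `u`, is completed to a
star as in a polygon: among the edges that cross both sides of the angle take the extremal
endpoint on either side; the missing sides of the star are crossed by no two crossing edges, so
they belong to `T` by maximality. Two things differ from the polygon. First, adding an edge to `T`
adds all its translates, so a missing edge could be excluded by its own translates only; this does
not happen up to length `2 n`. Second, longer edges have to be excluded by hand, by comparison
with the infinite star formed by the translates of the edge of length `2 n`.
-/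

namespace HalfCylinder

section LinearOrder

variable {α : Type*} [LinearOrder α] {A : α → α → Prop}

/-- No three pairwise crossing pairs are related by `A`, which is thought of as the set of pairs of
endpoints of a set of edges. -/
def NoTripleCrossing (A : α → α → Prop) : Prop :=
  ∀ ⦃a₁ a₂ a₃ b₁ b₂ b₃ : α⦄, a₁ < a₂ → a₂ < a₃ → a₃ < b₁ → b₁ < b₂ → b₂ < b₃ →
    A a₁ b₁ → A a₂ b₂ → A a₃ b₃ → False

/-- The pair `p < q` is crossed by two pairs related by `A` that cross each other. One endpoint of
either pair lies between `p` and `q`; the disjunction says that the other two endpoints `g₂` and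
`h₂` come after `q` and before `p` in this cyclic order. -/
def DoublyCrossed (A : α → α → Prop) (p q : α) : Prop :=
  ∃ g₁ h₁ g₂ h₂ : α, A g₁ g₂ ∧ A h₁ h₂ ∧ p < g₁ ∧ g₁ < h₁ ∧ h₁ < q ∧
    ((q < g₂ ∧ g₂ < h₂) ∨ (q < g₂ ∧ h₂ < p) ∨ (g₂ < h₂ ∧ h₂ < p))

/-- The five edges of the `2`-star with vertices `u < x < w < v < y` are related by `A`. The star is
seen from `u`, where it has the angle between `w` and `v`. -/
structure IsStar (A : α → α → Prop) (u x w v y : α) : Prop where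
  u_lt_x : u < x
  x_lt_w : x < w
  w_lt_v : w < v
  v_lt_y : v < y
  adj_uw : A u w
  adj_uv : A u v
  adj_xv : A x v
  adj_wy : A w y
  adj_xy : A x y

/-- An angle of `A` at the least element `u`: two consecutive neighbours `w < v` of `u`. -/
structure IsAngle (A : α → α → Prop) (u w v : α) : Prop where
  isBot : IsBot u
  w_lt_v : w < v
  adj_uw : A u w
  adj_uv : A u v
  not_adj : ∀ t, w < t → t < v → ¬ A u t

/-- The pair `x < y` is related by `A` and crosses both sides of the angle at `u` between `w` and
`v`. -/
structure CrossesAngle (A : α → α → Prop) (u w v x y : α) : Prop where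
  u_lt_x : u < x
  x_lt_w : x < w
  v_lt_y : v < y
  adj : A x y

namespace IsStar

variable {u x w v y x' w' v' y' t : α}

theorem not_adj (h : IsStar A u x w v y) (hA : NoTripleCrossing A) (hwt : w < t) (htv : t < v) :
    ¬ A u t := fun hut =>
  hA h.u_lt_x h.x_lt_w hwt htv h.v_lt_y hut h.adj_xv h.adj_wy

theorem x_le_x (h : IsStar A u x w v y) (h' : IsStar A u x' w v y') (hA : NoTripleCrossing A) :
    x ≤ x' := by
  by_contra! hlt
  exact hA h'.u_lt_x hlt h.x_lt_w h.w_lt_v h.v_lt_y h.adj_uw h'.adj_xv h.adj_xy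

theorem y_le_y (h : IsStar A u x w v y) (h' : IsStar A u x' w v y') (hA : NoTripleCrossing A) :
    y ≤ y' := by
  by_contra! hlt
  exact hA h'.u_lt_x h'.x_lt_w h.w_lt_v h'.v_lt_y hlt h.adj_uv h'.adj_xy h.adj_wy

theorem unique_of_angle (h : IsStar A u x w v y) (h' : IsStar A u x' w v y')
    (hA : NoTripleCrossing A) : x = x' ∧ y = y' :=
  ⟨(h.x_le_x h' hA).antisymm (h'.x_le_x h hA), (h.y_le_y h' hA).antisymm (h'.y_le_y h hA)⟩

theorem unique_of_left (h : IsStar A u x w v y) (h' : IsStar A u x' w v' y')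
    (hA : NoTripleCrossing A) : x = x' ∧ v = v' ∧ y = y' := by
  rcases lt_trichotomy v v' with hlt | rfl | hlt
  · exact (h'.not_adj hA h.w_lt_v hlt h.adj_uv).elim
  · exact ⟨(h.unique_of_angle h' hA).1, rfl, (h.unique_of_angle h' hA).2⟩
  · exact (h.not_adj hA h'.w_lt_v hlt h'.adj_uv).elim

theorem unique_of_right (h : IsStar A u x w v y) (h' : IsStar A u x' w' v y')
    (hA : NoTripleCrossing A) : x = x' ∧ w = w' ∧ y = y' := by
  rcases lt_trichotomy w w' with hlt | rfl | hlt
  · exact (h.not_adj hA hlt h'.w_lt_v h'.adj_uw).elim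
  · exact ⟨(h.unique_of_angle h' hA).1, rfl, (h.unique_of_angle h' hA).2⟩
  · exact (h'.not_adj hA hlt h.w_lt_v h.adj_uw).elim

end IsStar

namespace IsAngle

variable {u w v x y x₀ y₀ : α}

theorem not_doublyCrossed_left (h : IsAngle A u w v) (hA : NoTripleCrossing A)
    [Std.Symm A] (hxy : CrossesAngle A u w v x y)
    (hmax : ∀ a b, CrossesAngle A u w v a b → a ≤ x) : ¬ DoublyCrossed A x v := by
  rintro ⟨g₁, h₁, g₂, h₂, hg, hh, hxg, hgh, hhv, ⟨hvg, hgh'⟩ | ⟨hvg, hhx⟩ | ⟨hgh', hhx⟩⟩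
  · exact hA (hxy.u_lt_x.trans hxg) hgh hhv hvg hgh' h.adj_uv hg hh
  · have hwg : w ≤ g₁ := by
      by_contra! hgw
      exact (hmax g₁ g₂ ⟨hxy.u_lt_x.trans hxg, hgw, hvg, hg⟩).not_gt hxg
    rcases (h.isBot h₂).eq_or_lt with rfl | hu
    · exact h.not_adj h₁ (hwg.trans_lt hgh) hhv (symm hh)
    · exact hA hu hhx hxy.x_lt_w (hwg.trans_lt hgh) (hhv.trans hxy.v_lt_y) h.adj_uw (symm hh)
        hxy.adj
  · exact hA hgh' hhx hxg hgh (hhv.trans hxy.v_lt_y) (symm hg) (symm hh) hxy.adj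

theorem not_doublyCrossed_right (h : IsAngle A u w v) (hA : NoTripleCrossing A)
    [Std.Symm A] (hxy : CrossesAngle A u w v x y)
    (hmin : ∀ a b, CrossesAngle A u w v a b → y ≤ b) : ¬ DoublyCrossed A w y := by
  rintro ⟨g₁, h₁, g₂, h₂, hg, hh, hwg, hgh, hhy, ⟨hyg, hgh'⟩ | ⟨hyg, hhw⟩ | ⟨hgh', hhw⟩⟩
  · exact hA (hxy.x_lt_w.trans hwg) hgh hhy hyg hgh' hxy.adj hg hh
  · rcases lt_or_ge h₂ x with hhx | hxh
    · exact hA hhx (hxy.x_lt_w.trans hwg) hgh hhy hyg (symm hh) hxy.adj hg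
    have hhv : h₁ ≤ v := by
      by_contra! hvh
      exact (hmin h₂ h₁ ⟨hxy.u_lt_x.trans_le hxh, hhw, hvh, symm hh⟩).not_gt hhy
    exact hA hxy.u_lt_x (hxy.x_lt_w.trans hwg) (hgh.trans_le hhv) hxy.v_lt_y hyg h.adj_uv hxy.adj hg
  · rcases (h.isBot g₂).eq_or_lt with rfl | hu
    · have hvg : v ≤ g₁ := by
        by_contra! hgv
        exact h.not_adj g₁ hwg hgv (symm hg)
      exact (hmin h₂ h₁ ⟨hgh', hhw, hvg.trans_lt hgh, symm hh⟩).not_gt hhy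
    · exact hA hu hgh' hhw hwg hgh h.adj_uw (symm hg) (symm hh)

theorem not_doublyCrossed_outer (h : IsAngle A u w v) (hA : NoTripleCrossing A)
    [Std.Symm A] (hxy₀ : CrossesAngle A u w v x y₀) (hx₀y : CrossesAngle A u w v x₀ y)
    (hyy₀ : y ≤ y₀) (hmax : ∀ a b, CrossesAngle A u w v a b → a ≤ x) :
    ¬ DoublyCrossed A x y := by
  have hx₀x : x₀ ≤ x := hmax x₀ y hx₀y
  rintro ⟨g₁, h₁, g₂, h₂, hg, hh, hxg, hgh, hhy, ⟨hyg, hgh'⟩ | ⟨hyg, hhx⟩ | ⟨hgh', hhx⟩⟩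
  · exact hA (hx₀x.trans_lt hxg) hgh hhy hyg hgh' hx₀y.adj hg hh
  · rcases lt_or_ge h₂ x₀ with hhx₀ | hx₀h
    · exact hA hhx₀ (hx₀x.trans_lt hxg) hgh hhy hyg (symm hh) hx₀y.adj hg
    have hwg : w ≤ g₁ := by
      by_contra! hgw
      exact (hmax g₁ g₂ ⟨hxy₀.u_lt_x.trans hxg, hgw, hx₀y.v_lt_y.trans hyg, hg⟩).not_gt hxg
    exact hA (hx₀y.u_lt_x.trans_le hx₀h) hhx hxy₀.x_lt_w (hwg.trans_lt hgh) (hhy.trans_le hyy₀)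
      h.adj_uw (symm hh) hxy₀.adj
  · exact hA hgh' hhx hxg hgh (hhy.trans_le hyy₀) (symm hg) (symm hh) hxy₀.adj

theorem exists_not_doublyCrossed (h : IsAngle A u w v) (hA : NoTripleCrossing A)
    [Std.Symm A] (hfin : {e : α × α | CrossesAngle A u w v e.1 e.2}.Finite)
    (hne : ∃ x y, CrossesAngle A u w v x y) :
    ∃ x y x₀ y₀, CrossesAngle A u w v x y₀ ∧ CrossesAngle A u w v x₀ y ∧ x₀ ≤ x ∧
      ¬ DoublyCrossed A x v ∧ ¬ DoublyCrossed A w y ∧ ¬ DoublyCrossed A x y := by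
  obtain ⟨a, b, hab⟩ := hne
  obtain ⟨⟨x, y₀⟩, hxy₀, hmax⟩ := Set.exists_max_image _ Prod.fst hfin ⟨(a, b), hab⟩
  obtain ⟨⟨x₀, y⟩, hx₀y, hmin⟩ := Set.exists_min_image _ Prod.snd hfin ⟨(a, b), hab⟩
  have hmax : ∀ a b, CrossesAngle A u w v a b → a ≤ x := fun a b hab => hmax (a, b) hab
  have hmin : ∀ a b, CrossesAngle A u w v a b → y ≤ b := fun a b hab => hmin (a, b) hab
  exact ⟨x, y, x₀, y₀, hxy₀, hx₀y, hmax _ _ hx₀y,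
    h.not_doublyCrossed_left hA hxy₀ hmax, h.not_doublyCrossed_right hA hx₀y hmin,
    h.not_doublyCrossed_outer hA hxy₀ hx₀y (hmin _ _ hxy₀) hmax⟩

end IsAngle

end LinearOrder

/-- `A` is the adjacency relation of an `n`-periodic set of edges of the universal cover, without
triple crossings, that is maximal: adding a missing edge and its translates creates a triple
crossing. -/
structure IsPeriodicMaximal (n : ℤ) (A : ℤ → ℤ → Prop) : Prop where
  pos : 0 < n
  add_mul : ∀ ⦃p q⦄ (l : ℤ), A p q → A (p + l * n) (q + l * n)
  noTripleCrossing : NoTripleCrossing A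
  maximal : ∀ ⦃p q⦄, p < q → ¬ A p q → ¬ NoTripleCrossing fun a b =>
    A a b ∨ ∃ l : ℤ, a = p + l * n ∧ b = q + l * n

/-- `z` is a vertex of the infinite star, whose edges are the edges `[z, z + 2 n]` of maximal
length. -/
def IsInfiniteStarVertex (n : ℤ) (A : ℤ → ℤ → Prop) (z : ℤ) : Prop := A z (z + 2 * n)

/-- `[p, q]` joins vertices of the infinite star at distance at least `3 n`. Such an edge is missing
from `A` although no two crossing edges of `A` need cross it: it is excluded by its own
translates. -/
structure IsLongChord (n : ℤ) (A : ℤ → ℤ → Prop) (p q : ℤ) : Prop where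
  left : IsInfiniteStarVertex n A p
  right : IsInfiniteStarVertex n A q
  le : p + 3 * n ≤ q

theorem add_mul_eq_of_lt_of_lt {n p q l m : ℤ} (hn : 0 < n) (hlen : q ≤ p + 2 * n)
    (hlt : p + l * n < p + m * n) (hgt : p + m * n < q + l * n) :
    p + m * n = p + l * n + n := by
  have hlm : l < m := by by_contra! hc; nlinarith
  have hml : m < l + 2 := by by_contra! hc; nlinarith
  obtain rfl : m = l + 1 := by lia
  ring

namespace IsPeriodicMaximal

variable {n a b c d p q z : ℤ} {A : ℤ → ℤ → Prop}

theorem add (h : IsPeriodicMaximal n A) (hpq : A p q) : A (p + n) (q + n) := by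
  simpa only [one_mul] using h.add_mul 1 hpq

theorem sub (h : IsPeriodicMaximal n A) (hpq : A p q) : A (p - n) (q - n) := by
  simpa only [neg_one_mul, ← sub_eq_add_neg] using h.add_mul (-1) hpq

theorem le_add (h : IsPeriodicMaximal n A) (hpq : A p q) : q ≤ p + 2 * n := by
  by_contra! hlt
  have hn := h.pos
  have hpq' := h.add hpq
  exact h.noTripleCrossing (by lia) (by lia) (by lia) (by lia) (by lia) hpq hpq' (h.add hpq')

theorem doublyCrossed_of_add_mul (h : IsPeriodicMaximal n A) (l : ℤ)
    (hX : DoublyCrossed A (p + l * n) (q + l * n)) : DoublyCrossed A p q := by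
  obtain ⟨g₁, h₁, g₂, h₂, hg, hh, hX⟩ := hX
  refine ⟨_, _, _, _, h.add_mul (-l) hg, h.add_mul (-l) hh, ?_⟩
  simp only [neg_mul]
  lia

/-- The three alternatives list the positions of an edge `[c, d]` that forms a triple crossing with
`[p, q]` and `[p + n, q + n]`. -/
theorem doublyCrossed_or_crosses_translate [Std.Symm A] (h : IsPeriodicMaximal n A) (hpq : p < q)
    (hlen : q ≤ p + 2 * n) (hA : ¬ A p q) :
    DoublyCrossed A p q ∨ ∃ c d, A c d ∧
      ((c < p ∧ p + n < d ∧ d < q) ∨ (p < c ∧ c < p + n ∧ p + n < q ∧ q < d ∧ d < q + n) ∨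
        (p + n < c ∧ c < q ∧ q + n < d)) := by
  have hn := h.pos
  have translate {l m : ℤ} := add_mul_eq_of_lt_of_lt (l := l) (m := m) hn hlen
  have hmax := h.maximal hpq hA
  simp only [NoTripleCrossing, not_forall] at hmax
  obtain ⟨a₁, a₂, a₃, b₁, b₂, b₃, ha₁₂, ha₂₃, hab, hb₁₂, hb₂₃, e₁, e₂, e₃, -⟩ := hmax
  rcases e₁ with e₁ | ⟨l₁, rfl, rfl⟩ <;> rcases e₂ with e₂ | ⟨l₂, rfl, rfl⟩ <;>
    rcases e₃ with e₃ | ⟨l₃, rfl, rfl⟩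
  · exact (h.noTripleCrossing ha₁₂ ha₂₃ hab hb₁₂ hb₂₃ e₁ e₂ e₃).elim
  · exact .inl <| h.doublyCrossed_of_add_mul l₃
      ⟨b₁, b₂, a₁, a₂, symm e₁, symm e₂, hab, hb₁₂, hb₂₃, .inr (.inr ⟨ha₁₂, ha₂₃⟩)⟩
  · exact .inl <| h.doublyCrossed_of_add_mul l₂
      ⟨a₃, b₁, b₃, a₁, e₃, symm e₁, ha₂₃, hab, hb₁₂, .inr (.inl ⟨hb₂₃, ha₁₂⟩)⟩
  · have heq := translate ha₂₃ (by lia)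
    refine .inr ⟨_, _, h.add_mul (-l₂) e₁, .inl ?_⟩
    simp only [neg_mul]
    lia
  · exact .inl <| h.doublyCrossed_of_add_mul l₁
      ⟨a₂, a₃, b₂, b₃, e₂, e₃, ha₁₂, ha₂₃, hab, .inl ⟨hb₁₂, hb₂₃⟩⟩
  · have heq := translate (ha₁₂.trans ha₂₃) (by lia)
    refine .inr ⟨_, _, h.add_mul (-l₁) e₂, .inr (.inl ?_)⟩
    simp only [neg_mul]
    lia
  · have heq := translate ha₁₂ (by lia)
    refine .inr ⟨_, _, h.add_mul (-l₁) e₃, .inr (.inr ?_)⟩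
    simp only [neg_mul]
    lia
  · have heq₁₂ := translate ha₁₂ (by lia)
    have heq₂₃ := translate ha₂₃ (by lia)
    lia

theorem doublyCrossed_of_not_adj_add [Std.Symm A] (h : IsPeriodicMaximal n A)
    (hA : ¬ A a (a + n)) : DoublyCrossed A a (a + n) := by
  have hn := h.pos
  rcases h.doublyCrossed_or_crosses_translate (by lia) (by lia) hA with hX | ⟨c, d, -, hcd⟩
  · exact hX
  · lia

/-- The edge `[c, d]` of length at most `n` crosses both `[a, b]` and its translate by `n`, but does
not cross its own translate. A second edge crossing `[a, b]` comes from `[a, a + n]`: either the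
translate of `[a, a + n]`, or a translate of one of the two edges crossing `[a, a + n]`. -/
theorem doublyCrossed_of_crosses_translate [Std.Symm A] (h : IsPeriodicMaximal n A) (hcd : A c d)
    (hac : a < c) (hca : c < a + n) (hab : a + n < b) (hbd : b < d) (hdc : d ≤ c + n) :
    DoublyCrossed A a b := by
  by_cases haa : A a (a + n)
  · exact ⟨c, a + n, d, a + n + n, hcd, h.add haa, by lia, by lia, by lia, by lia⟩
  obtain ⟨g₁, h₁, g₂, h₂, hg, hh, hX⟩ := h.doublyCrossed_of_not_adj_add haa
  by_cases hout : (g₂ < a ∨ b < g₂) ∧ (h₂ < a ∨ b < h₂)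
  · exact ⟨g₁, h₁, g₂, h₂, hg, hh, by lia, by lia, by lia, by lia⟩
  have hg₂ : a + n < g₂ ∧ g₂ ≤ b := by lia
  rcases lt_or_ge g₁ c with hgc | hcg
  · exact ⟨g₂ - n, d - n, g₁ - n, c - n, symm (h.sub hg), symm (h.sub hcd), by lia, by lia,
      by lia, by lia⟩
  by_cases hh₂ : a + n < h₂ ∧ h₂ < b + n
  · exact ⟨g₂ - n, h₂ - n, g₁ - n, h₁ - n, symm (h.sub hg), symm (h.sub hh), by lia, by lia,
      by lia, by lia⟩
  · exact ⟨c, h₁, d, h₂, hcd, hh, by lia, by lia, by lia, by lia⟩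

theorem doublyCrossed_of_not_adj [Std.Symm A] (h : IsPeriodicMaximal n A) (hpq : p < q)
    (hlen : q ≤ p + 2 * n) (hA : ¬ A p q) : DoublyCrossed A p q := by
  have hn := h.pos
  rcases h.doublyCrossed_or_crosses_translate hpq hlen hA with
    hX | ⟨c, d, hcd, hc | ⟨hpc, hcp, hpq', hqd, hdq⟩ | hc⟩
  · exact hX
  · have hdc := h.le_add hcd
    exact ⟨c + n, d, d + n, c, h.add hcd, symm hcd, by lia, by lia, by lia, by lia⟩
  · rcases le_or_gt d (c + n) with hdc | hdc
    · exact h.doublyCrossed_of_crosses_translate hcd hpc hcp hpq' hqd hdc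
    · exact ⟨c, d - n, d, c - n, hcd, symm (h.sub hcd), by lia, by lia, by lia, by lia⟩
  · exact ⟨c - n, c, d - n, d, h.sub hcd, hcd, by lia, by lia, by lia, by lia⟩

theorem adj_of_le_add_two [Std.Symm A] (h : IsPeriodicMaximal n A) (hpq : p < q)
    (hq : q ≤ p + 2) : A p q := by
  have hn := h.pos
  by_contra hA
  obtain ⟨g₁, h₁, g₂, h₂, -, -, hX⟩ := h.doublyCrossed_of_not_adj hpq (by lia) hA
  lia

/-- Otherwise, among the pairs of crossing edges over `0`, take one whose first edge `[p₁, p₂]` ends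
last. A pair of crossing edges over `p₂` then yields an edge over `0` that ends later. -/
theorem exists_not_under_crossing (h : IsPeriodicMaximal n A) :
    ∃ a, ∀ p₁ q₁ p₂ q₂, p₁ < q₁ → q₁ < a → a < p₂ → p₂ < q₂ → A p₁ p₂ → ¬ A q₁ q₂ := by
  by_contra! hcov
  let Ends (p₂ : ℤ) : Prop :=
    ∃ p₁ q₁ q₂, p₁ < q₁ ∧ q₁ < 0 ∧ 0 < p₂ ∧ p₂ < q₂ ∧ A p₁ p₂ ∧ A q₁ q₂
  have hbdd : ∀ p₂, Ends p₂ → p₂ ≤ 2 * n := by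
    rintro p₂ ⟨p₁, q₁, q₂, hpq₁, hq₁, -, -, hp, -⟩
    have hlen := h.le_add hp
    lia
  have hne : ∃ p₂, Ends p₂ := by
    obtain ⟨p₁, q₁, p₂, q₂, hends⟩ := hcov 0
    exact ⟨p₂, p₁, q₁, q₂, hends⟩
  obtain ⟨p₂, ⟨p₁, q₁, q₂, hpq₁, hq₁, hp₂, hpq₂, hp, hq⟩, hmax⟩ :=
    Int.exists_greatest_of_bdd ⟨2 * n, hbdd⟩ hne
  obtain ⟨r₁, s₁, r₂, s₂, hrs₁, hs₁, hr₂, hrs₂, hr, hs⟩ := hcov p₂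
  have hs₁_nonneg : 0 ≤ s₁ := by
    by_contra! hneg
    exact (hmax r₂ ⟨r₁, s₁, s₂, hrs₁, hneg, by lia, hrs₂, hr, hs⟩).not_gt hr₂
  have hs₂_le : s₂ ≤ q₂ := by
    by_contra! hlt
    exact h.noTripleCrossing hpq₁ (by lia) hs₁ hpq₂ hlt hp hq hs
  have hr₁_le : r₁ ≤ p₁ := by
    by_contra! hlt
    exact h.noTripleCrossing hlt hrs₁ hs₁ hr₂ hrs₂ hp hr hs
  exact (hmax r₂ ⟨r₁, q₁, q₂, by lia, hq₁, by lia, by lia, hr, hq⟩).not_gt hr₂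

theorem exists_isInfiniteStarVertex [Std.Symm A] (h : IsPeriodicMaximal n A) :
    ∃ z, IsInfiniteStarVertex n A z := by
  have hn := h.pos
  obtain ⟨z, hz⟩ := h.exists_not_under_crossing
  refine ⟨z, by_contra fun hA => ?_⟩
  obtain ⟨g₁, h₁, g₂, h₂, hg, hh, hzg, hgh, hhz, hX | hX | hX⟩ :=
    h.doublyCrossed_of_not_adj (by lia) le_rfl hA
  · exact hz _ _ _ _ (by lia) (by lia) (by lia) (by lia) (h.sub (h.sub hg)) (h.sub (h.sub hh))
  · have hglen := h.le_add hg
    have hhlen := h.le_add (symm hh)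
    exact hz _ _ _ _ (by lia) (by lia) (by lia) (by lia) (h.sub (h.sub hg)) (symm hh)
  · exact hz _ _ _ _ hX.1 hX.2 hzg hgh (symm hg) (symm hh)

theorem isInfiniteStarVertex_add_mul (h : IsPeriodicMaximal n A)
    (hz : IsInfiniteStarVertex n A z) (l : ℤ) : IsInfiniteStarVertex n A (z + l * n) := by
  simpa only [IsInfiniteStarVertex, add_right_comm] using h.add_mul l hz

theorem exists_isInfiniteStarVertex_le_lt (h : IsPeriodicMaximal n A)
    (hz : IsInfiniteStarVertex n A z) (p : ℤ) :
    ∃ l : ℤ, IsInfiniteStarVertex n A (z + l * n) ∧ z + l * n ≤ p ∧ p < z + l * n + n := by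
  have hle := Int.ediv_mul_le (p - z) h.pos.ne'
  have hlt := Int.lt_ediv_add_one_mul_self (p - z) h.pos
  rw [add_one_mul] at hlt
  exact ⟨(p - z) / n, h.isInfiniteStarVertex_add_mul hz _, by lia, by lia⟩

/-- An edge of `A` cannot pass over two consecutive vertices `z` and `z + n` of the infinite star,
as it would form a triple crossing with `[z - n, z + n]` and `[z, z + 2 n]`. -/
theorem le_add_of_lt (h : IsPeriodicMaximal n A) (hz : IsInfiniteStarVertex n A z) (hpq : A p q)
    (hpz : p < z) : q ≤ z + n := by
  by_contra! hlt
  have hlen := h.le_add hpq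
  exact h.noTripleCrossing (by lia) hpz (by lia) (by lia) (by lia) (h.sub hz) hpq hz

theorem eq_add_mul_of_isInfiniteStarVertex (h : IsPeriodicMaximal n A)
    (ha : IsInfiniteStarVertex n A a) (hb : IsInfiniteStarVertex n A b) :
    ∃ l : ℤ, b = a + l * n := by
  obtain ⟨l, -, hle, hlt⟩ := h.exists_isInfiniteStarVertex_le_lt ha b
  refine ⟨l, hle.antisymm' (le_of_not_gt fun hgt => ?_)⟩
  have hend := h.le_add_of_lt (h.isInfiniteStarVertex_add_mul ha (l + 1)) hb (by lia)
  lia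

theorem adj_or_doublyCrossed_or_isLongChord [Std.Symm A] (h : IsPeriodicMaximal n A)
    (hpq : p < q) : A p q ∨ DoublyCrossed A p q ∨ IsLongChord n A p q := by
  have hn := h.pos
  rcases le_or_gt q (p + 2 * n) with hlen | hlen
  · exact (em _).imp_right fun hA => .inl (h.doublyCrossed_of_not_adj hpq hlen hA)
  obtain ⟨z, hz⟩ := h.exists_isInfiniteStarVertex
  obtain ⟨l, hl, hlp, hpl⟩ := h.exists_isInfiniteStarVertex_le_lt hz p
  obtain ⟨m, hm, hmq, hqm⟩ := h.exists_isInfiniteStarVertex_le_lt hz q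
  right
  rcases hlp.eq_or_lt with rfl | hlp
  · rcases hmq.eq_or_lt with rfl | hmq
    · have hlm : l + 2 < m := by by_contra! hc; nlinarith
      exact .inr ⟨hl, hm, by nlinarith⟩
    · exact .inl ⟨_, _, _, _, h.sub hm, hm, by lia, by lia, by lia, .inl (by lia)⟩
  · exact .inl ⟨_, _, _, _, symm (h.sub hl), symm hl, by lia, by lia, by lia,
      .inr (.inr (by lia))⟩

end IsPeriodicMaximal

/-- The integers in the cyclic order cut just before `u`: first `u, u + 1, …`, then `…, u - 1`. An
angle at `u`, whichever of its sides it faces, is an angle at the least element of this order. -/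
@[ext]
structure CutAt (u : ℤ) where
  val : ℤ

namespace CutAt

variable {A : ℤ → ℤ → Prop} {u : ℤ} {p q : CutAt u}

instance (u : ℤ) : LinearOrder (CutAt u) :=
  LinearOrder.lift' (fun t => toLex ((if t.val < u then 1 else 0 : ℤ), t.val)) fun _ _ hst =>
    CutAt.ext (congrArg (fun r => (ofLex r).2) hst)

theorem lt_iff : p < q ↔ (u ≤ p.val ∧ q.val < u) ∨ (p.val < q.val ∧ (u ≤ p.val ∨ q.val < u)) := by
  change toLex ((if p.val < u then 1 else 0 : ℤ), p.val) <
    toLex ((if q.val < u then 1 else 0 : ℤ), q.val) ↔ _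
  rw [Prod.Lex.toLex_lt_toLex]
  split_ifs <;> lia

theorem le_iff : p ≤ q ↔ (u ≤ p.val ∧ q.val < u) ∨ (p.val ≤ q.val ∧ (u ≤ p.val ∨ q.val < u)) := by
  rw [← not_lt, lt_iff]
  lia

theorem isBot_mk_self (u : ℤ) : IsBot (⟨u⟩ : CutAt u) := fun t => by
  rw [le_iff]
  lia

/-- A relation on the integers as a relation on the cut order. -/
def lift (A : ℤ → ℤ → Prop) (u : ℤ) (s t : CutAt u) : Prop := A s.val t.val

instance [Std.Symm A] : Std.Symm (lift A u) := ⟨fun _ _ hst => symm (r := A) hst⟩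

/-- The six endpoints of a triple crossing may be listed from any one of them. -/
theorem noTripleCrossing [Std.Symm A] (hA : NoTripleCrossing A) (u : ℤ) :
    NoTripleCrossing (lift A u) := by
  rintro ⟨a₁⟩ ⟨a₂⟩ ⟨a₃⟩ ⟨b₁⟩ ⟨b₂⟩ ⟨b₃⟩ ha₁₂ ha₂₃ hab hb₁₂ hb₂₃ (e₁ : A a₁ b₁) (e₂ : A a₂ b₂)
    (e₃ : A a₃ b₃)
  simp only [lt_iff] at ha₁₂ ha₂₃ hab hb₁₂ hb₂₃
  by_cases hb₃ : u ≤ b₃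
  · exact hA (by lia) (by lia) (by lia) (by lia) (by lia) e₁ e₂ e₃
  by_cases hb₂ : u ≤ b₂
  · exact hA (by lia) (by lia) (by lia) (by lia) (by lia) (symm e₃) e₁ e₂
  by_cases hb₁ : u ≤ b₁
  · exact hA (by lia) (by lia) (by lia) (by lia) (by lia) (symm e₂) (symm e₃) e₁
  by_cases ha₃ : u ≤ a₃
  · exact hA (by lia) (by lia) (by lia) (by lia) (by lia) (symm e₁) (symm e₂) (symm e₃)
  by_cases ha₂ : u ≤ a₂
  · exact hA (by lia) (by lia) (by lia) (by lia) (by lia) e₃ (symm e₁) (symm e₂)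
  by_cases ha₁ : u ≤ a₁
  · exact hA (by lia) (by lia) (by lia) (by lia) (by lia) e₂ e₃ (symm e₁)
  · exact hA (by lia) (by lia) (by lia) (by lia) (by lia) e₁ e₂ e₃

theorem doublyCrossed_of_lt (hpq : p < q)
    (hX : DoublyCrossed A p.val q.val) : DoublyCrossed (lift A u) p q := by
  obtain ⟨g₁, h₁, g₂, h₂, hg, hh, hX⟩ := hX
  refine ⟨⟨g₁⟩, ⟨h₁⟩, ⟨g₂⟩, ⟨h₂⟩, hg, hh, ?_⟩
  simp only [lt_iff] at hpq ⊢
  omega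

theorem doublyCrossed_of_gt [Std.Symm A] (hpq : p < q)
    (hX : DoublyCrossed A q.val p.val) : DoublyCrossed (lift A u) p q := by
  obtain ⟨g₁, h₁, g₂, h₂, hg, hh, hX⟩ := hX
  refine ⟨⟨g₂⟩, ⟨h₂⟩, ⟨g₁⟩, ⟨h₁⟩, symm hg, symm hh, ?_⟩
  simp only [lt_iff] at hpq ⊢
  omega

end CutAt

open CutAt (lift)

/-- The integers `u, x, w, v, y`, in this cyclic order, are the vertices of a `2`-star whose edges
are related by `A`. -/
def IsCyclicStar (A : ℤ → ℤ → Prop) (u x w v y : ℤ) : Prop :=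
  IsStar (lift A u) ⟨u⟩ ⟨x⟩ ⟨w⟩ ⟨v⟩ ⟨y⟩

namespace IsPeriodicMaximal

variable {n p q u v w x x₀ y : ℤ} {A : ℤ → ℤ → Prop}

theorem lift_of_not_doublyCrossed [Std.Symm A] (h : IsPeriodicMaximal n A) {p q : CutAt u}
    (hpq : p < q) (hX : ¬ DoublyCrossed (lift A u) p q)
    (hlong : ¬ IsLongChord n A p.val q.val ∧ ¬ IsLongChord n A q.val p.val) : lift A u p q := by
  rcases lt_trichotomy p.val q.val with hlt | heq | hlt
  · rcases h.adj_or_doublyCrossed_or_isLongChord hlt with hA | hX' | hL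
    · exact hA
    · exact (hX (CutAt.doublyCrossed_of_lt hpq hX')).elim
    · exact (hlong.1 hL).elim
  · exact (hpq.ne (CutAt.ext heq)).elim
  · rcases h.adj_or_doublyCrossed_or_isLongChord hlt with hA | hX' | hL
    · exact symm (r := A) hA
    · exact (hX (CutAt.doublyCrossed_of_gt hpq hX')).elim
    · exact (hlong.2 hL).elim

/-- If `y` is a vertex of the infinite star, then so is `y + 2 n`, and `[u, v]` must not pass over
`y + 2 n` and `y + 3 n`. -/
theorem not_isLongChord_of_lt [Std.Symm A] (h : IsPeriodicMaximal n A) (huv : A u v)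
    (hxy : A x y) (hux : u < x) (hxp : x ≤ p) (hpv : p < v) :
    ¬ IsLongChord n A p y ∧ ¬ IsLongChord n A y p := by
  have hn := h.pos
  have hyx := h.le_add (symm hxy)
  have hxy := h.le_add hxy
  refine ⟨fun hL => ?_, fun hL => ?_⟩ <;> have hlong := hL.le
  · lia
  · have hend := h.le_add_of_lt (h.isInfiniteStarVertex_add_mul hL.left 2) huv (by lia)
    lia

theorem le_add_three_mul [Std.Symm A] (h : IsPeriodicMaximal n A)
    (hu : ¬ IsInfiniteStarVertex n A u) (huv : A u v) (huw : A u w) : w ≤ v + 3 * n := by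
  obtain ⟨a, ha⟩ := h.exists_isInfiniteStarVertex
  obtain ⟨l, hl, hle, hlt⟩ := h.exists_isInfiniteStarVertex_le_lt ha u
  have hlt_u : a + l * n < u := hle.lt_of_ne fun heq => hu (heq ▸ hl)
  have hw := h.le_add_of_lt (h.isInfiniteStarVertex_add_mul hl 1) huw (by lia)
  have hv : a + l * n ≤ v + n := by
    by_contra! hlt_v
    have hend := h.le_add_of_lt (h.isInfiniteStarVertex_add_mul hl (-1)) (symm huv) (by lia)
    lia
  lia

theorem finite_crossesAngle [Std.Symm A] (h : IsPeriodicMaximal n A) (huw : u < w) :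
    {e : CutAt u × CutAt u | CrossesAngle (lift A u) ⟨u⟩ ⟨w⟩ ⟨v⟩ e.1 e.2}.Finite := by
  refine Set.Finite.subset (((Set.finite_Ioo u w).image CutAt.mk).prod
    ((Set.finite_Icc (u - 2 * n) (w + 2 * n)).image CutAt.mk)) ?_
  rintro ⟨⟨x⟩, ⟨y⟩⟩ ⟨hux, hxw, -, hxy : A x y⟩
  simp only [CutAt.lt_iff] at hux hxw
  have hyx := h.le_add (symm hxy)
  have hxy := h.le_add hxy
  exact ⟨⟨x, by constructor <;> lia, rfl⟩, ⟨y, by constructor <;> lia, rfl⟩⟩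

/-- The second alternative is an angle that faces the inner boundary of the half-cylinder. -/
theorem exists_isCyclicStar [Std.Symm A] (h : IsPeriodicMaximal n A)
    (hangle : IsAngle (lift A u) ⟨u⟩ ⟨w⟩ ⟨v⟩) (hw : u + 2 ≤ w)
    (hv : w < v ∨ v + 2 ≤ u ∧ ¬ IsInfiniteStarVertex n A u) :
    ∃ x y, IsCyclicStar A u x w v y := by
  have huw : A u w := hangle.adj_uw
  have huv : A u v := hangle.adj_uv
  have hv_le := h.le_add huv
  have hne : CrossesAngle (lift A u) ⟨u⟩ ⟨w⟩ ⟨v⟩ ⟨u + 1⟩ ⟨u - 1⟩ :=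
    ⟨by rw [CutAt.lt_iff]; lia, by rw [CutAt.lt_iff]; lia, by rw [CutAt.lt_iff]; lia,
      symm (r := A) (h.adj_of_le_add_two (by lia) (by lia))⟩
  obtain ⟨⟨x⟩, ⟨y⟩, ⟨x₀⟩, ⟨y₀⟩, hxy₀, hx₀y, hx₀x, hXxv, hXwy, hXxy⟩ :=
    hangle.exists_not_doublyCrossed (CutAt.noTripleCrossing h.noTripleCrossing u)
      (h.finite_crossesAngle (by lia)) ⟨_, _, hne⟩
  have hxw := hxy₀.x_lt_w
  have hwv := hangle.w_lt_v
  have hvy := hx₀y.v_lt_y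
  have hadj : A x₀ y := hx₀y.adj
  have hux₀ := hx₀y.u_lt_x
  have hlong : (¬ IsLongChord n A x v ∧ ¬ IsLongChord n A v x) ∧
      (¬ IsLongChord n A w y ∧ ¬ IsLongChord n A y w) ∧
      ¬ IsLongChord n A x y ∧ ¬ IsLongChord n A y x := by
    simp only [CutAt.lt_iff, CutAt.le_iff] at hxw hwv hvy hux₀ hx₀x
    rcases hv with hwv' | ⟨hvu, hu⟩
    · exact ⟨⟨fun hL => by have := hL.le; lia, fun hL => by have := hL.le; lia⟩,
        h.not_isLongChord_of_lt huv hadj (by lia) (by lia) (by lia),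
        h.not_isLongChord_of_lt huv hadj (by lia) (by lia) (by lia)⟩
    · have hwv' := h.le_add_three_mul hu huv huw
      refine ⟨⟨?_, ?_⟩, ⟨?_, ?_⟩, ?_, ?_⟩ <;> intro hL <;> have := hL.le <;> lia
  have hxv := hxw.trans hwv
  have hwy := hwv.trans hvy
  exact ⟨x, y, hux₀.trans_le hx₀x, hxw, hwv, hvy, huw, huv,
    h.lift_of_not_doublyCrossed hxv hXxv hlong.1, h.lift_of_not_doublyCrossed hwy hXwy hlong.2.1,
    h.lift_of_not_doublyCrossed (hxv.trans hvy) hXxy hlong.2.2⟩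

/-- The star has its angle at `p` below `[p, q]`. -/
theorem exists_isCyclicStar_of_outer [Std.Symm A] (h : IsPeriodicMaximal n A) (hpq : A p q)
    (hlen : p + 2 < q) : ∃ x w y, IsCyclicStar A p x w q y := by
  obtain ⟨w, ⟨hw, hwq, hpw⟩, hmax⟩ := Int.exists_greatest_of_bdd
    (P := fun w => p + 2 ≤ w ∧ w < q ∧ A p w) ⟨q, fun _ hw => hw.2.1.le⟩
    ⟨p + 2, le_rfl, hlen, h.adj_of_le_add_two (by lia) le_rfl⟩
  have hangle : IsAngle (lift A p) ⟨p⟩ ⟨w⟩ ⟨q⟩ := by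
    refine ⟨CutAt.isBot_mk_self p, by rw [CutAt.lt_iff]; lia, hpw, hpq, fun t hwt htq hpt => ?_⟩
    rw [CutAt.lt_iff] at hwt htq
    exact (hmax t.val ⟨by lia, by lia, hpt⟩).not_gt (by lia)
  obtain ⟨x, y, hS⟩ := h.exists_isCyclicStar hangle hw (.inl hwq)
  exact ⟨x, w, y, hS⟩

/-- The star has its angle at `p` above `[p, q]`. If no edge from `p` passes over `q`, then this
angle faces the inner boundary. -/
theorem exists_isCyclicStar_of_inner [Std.Symm A] (h : IsPeriodicMaximal n A) (hpq : A p q)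
    (hlen : p + 2 ≤ q) (hne : q ≠ p + 2 * n) : ∃ x v y, IsCyclicStar A p x q v y := by
  by_cases hex : ∃ v, q < v ∧ A p v
  · obtain ⟨v, ⟨hqv, hpv⟩, hmin⟩ := Int.exists_least_of_bdd ⟨q, fun _ hv => hv.1.le⟩ hex
    have hangle : IsAngle (lift A p) ⟨p⟩ ⟨q⟩ ⟨v⟩ := by
      refine ⟨CutAt.isBot_mk_self p, by rw [CutAt.lt_iff]; lia, hpq, hpv, fun t hqt htv hpt => ?_⟩
      rw [CutAt.lt_iff] at hqt htv
      exact (hmin t.val ⟨by lia, hpt⟩).not_gt (by lia)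
    obtain ⟨x, y, hS⟩ := h.exists_isCyclicStar hangle hlen (.inl hqv)
    exact ⟨x, v, y, hS⟩
  · push Not at hex
    obtain ⟨v, hpv, hmin⟩ := Int.exists_least_of_bdd (P := A p)
      ⟨p - 2 * n, fun t ht => by have := h.le_add (symm ht); lia⟩ ⟨q, hpq⟩
    have hvp := hmin (p - 2) (symm (h.adj_of_le_add_two (by lia) (by lia)))
    have hangle : IsAngle (lift A p) ⟨p⟩ ⟨q⟩ ⟨v⟩ := by
      refine ⟨CutAt.isBot_mk_self p, by rw [CutAt.lt_iff]; lia, hpq, hpv, fun t hqt htv hpt => ?_⟩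
      rw [CutAt.lt_iff] at hqt htv
      have hvt := hmin t.val hpt
      exact hex t.val (by lia) hpt
    have hp : ¬ IsInfiniteStarVertex n A p := fun hp =>
      hex _ ((h.le_add hpq).lt_of_ne hne) hp
    obtain ⟨x, y, hS⟩ := h.exists_isCyclicStar hangle hlen (.inr ⟨by lia, hp⟩)
    exact ⟨x, v, y, hS⟩

end IsPeriodicMaximal

namespace CoverStar

/-- The edges of `S` are related by `A`. -/
def EdgesAdj (A : ℤ → ℤ → Prop) (S : CoverStar 2) : Prop := ∀ i, A (S.z i) (S.z (i + 2))

/-- The edges `[z₀, z₃]` and `[z₁, z₄]` of a `2`-star, which have the star below them. -/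
def upperSide (S : CoverStar 2) (i : Fin 2) : CoverEdge :=
  ⟨S.z (i.castLE (by decide)), S.z (i.castLE (by decide) + 3),
    S.strictMono (by decide +revert)⟩

/-- The edges `[z₀, z₂]`, `[z₁, z₃]` and `[z₂, z₄]` of a `2`-star, which have the star above
them. -/
def lowerSide (S : CoverStar 2) (i : Fin 3) : CoverEdge :=
  ⟨S.z (i.castLE (by decide)), S.z (i.castLE (by decide) + 2),
    S.strictMono (by decide +revert)⟩

theorem z_lt_z_succ (S : CoverStar 2) :
    S.z 0 < S.z 1 ∧ S.z 1 < S.z 2 ∧ S.z 2 < S.z 3 ∧ S.z 3 < S.z 4 := by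
  refine ⟨?_, ?_, ?_, ?_⟩ <;> exact S.strictMono (by decide)

theorem two_lt_length_upperSide (S : CoverStar 2) (i : Fin 2) : 2 < (S.upperSide i).length := by
  have hS := S.z_lt_z_succ
  fin_cases i
  · exact (by lia : 2 < S.z 3 - S.z 0)
  · exact (by lia : 2 < S.z 4 - S.z 1)

theorem two_le_length_lowerSide (S : CoverStar 2) (i : Fin 3) : 2 ≤ (S.lowerSide i).length := by
  have hS := S.z_lt_z_succ
  fin_cases i
  · exact (by lia : 2 ≤ S.z 2 - S.z 0)
  · exact (by lia : 2 ≤ S.z 3 - S.z 1)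
  · exact (by lia : 2 ≤ S.z 4 - S.z 2)

theorem exists_length_lowerSide_lt (S : CoverStar 2) (i : Fin 3) :
    ∃ j, (S.lowerSide i).length < (S.upperSide j).length := by
  have hS := S.z_lt_z_succ
  fin_cases i
  · exact ⟨0, (by lia : S.z 2 - S.z 0 < S.z 3 - S.z 0)⟩
  · exact ⟨0, (by lia : S.z 3 - S.z 1 < S.z 3 - S.z 0)⟩
  · exact ⟨1, (by lia : S.z 4 - S.z 2 < S.z 4 - S.z 1)⟩

theorem eq_of_rotation {k : ℕ} {S R : CoverStar k} {i j : Fin (2 * k + 1)}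
    (h : ∀ m, S.z (i + m) = R.z (j + m)) : S = R ∧ i = j := by
  have hrange : Set.range S.z = Set.range R.z := by
    rw [← (Equiv.addLeft i).surjective.range_comp, ← (Equiv.addLeft j).surjective.range_comp R.z]
    exact congrArg Set.range (funext h)
  obtain rfl : S = R := CoverStar.ext ((S.strictMono.range_inj R.strictMono).1 hrange)
  exact ⟨rfl, S.strictMono.injective (by simpa using h 0)⟩

variable {A : ℤ → ℤ → Prop} {S R : CoverStar 2} {i j : Fin 5}

theorem EdgesAdj.adj_upperSide [Std.Symm A] (hS : S.EdgesAdj A) (i : Fin 2) :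
    A (S.upperSide i).lo (S.upperSide i).hi := by
  have hi : ∀ i : Fin 5, i + 3 + 2 = i := by decide
  have hadj := hS (i.castLE (by decide) + 3)
  rw [hi] at hadj
  exact symm (r := A) hadj

theorem EdgesAdj.adj_lowerSide (hS : S.EdgesAdj A) (i : Fin 3) :
    A (S.lowerSide i).lo (S.lowerSide i).hi :=
  hS (i.castLE (by decide))

theorem EdgesAdj.isCyclicStar [Std.Symm A] (hS : S.EdgesAdj A) (i : Fin 5) :
    IsCyclicStar A (S.z i) (S.z (i + 1)) (S.z (i + 2)) (S.z (i + 3)) (S.z (i + 4)) := by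
  have hlt {a b : Fin 5} : S.z a < S.z b ↔ a < b := S.strictMono.lt_iff_lt
  have hle {a b : Fin 5} : S.z a ≤ S.z b ↔ a ≤ b := S.strictMono.le_iff_le
  have hadj {a b : Fin 5} (hab : a + 2 = b) : A (S.z a) (S.z b) := hab ▸ hS a
  refine ⟨?_, ?_, ?_, ?_, hS i, symm (r := A) (hadj ?_), hadj ?_, hadj ?_, symm (r := A) (hadj ?_)⟩
  iterate 4 (simp only [CutAt.lt_iff, hlt, hle]; decide +revert)
  all_goals decide +revert

theorem EdgesAdj.eq_of_outer [Std.Symm A] (hA : NoTripleCrossing A) (hS : S.EdgesAdj A)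
    (hR : R.EdgesAdj A) (h₀ : S.z i = R.z j) (h₃ : S.z (i + 3) = R.z (j + 3)) :
    S = R ∧ i = j := by
  have hSi := hS.isCyclicStar i
  have hRj := hR.isCyclicStar j
  rw [h₀, h₃] at hSi
  obtain ⟨h₁, h₂, h₄⟩ := hSi.unique_of_right hRj (CutAt.noTripleCrossing hA _)
  simp only [CutAt.mk.injEq] at h₁ h₂ h₄
  refine eq_of_rotation fun m => ?_
  fin_cases m
  exacts [by simpa using h₀, h₁, h₂, h₃, h₄]

theorem EdgesAdj.eq_of_inner [Std.Symm A] (hA : NoTripleCrossing A) (hS : S.EdgesAdj A)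
    (hR : R.EdgesAdj A) (h₀ : S.z i = R.z j) (h₂ : S.z (i + 2) = R.z (j + 2)) :
    S = R ∧ i = j := by
  have hSi := hS.isCyclicStar i
  have hRj := hR.isCyclicStar j
  rw [h₀, h₂] at hSi
  obtain ⟨h₁, h₃, h₄⟩ := hSi.unique_of_left hRj (CutAt.noTripleCrossing hA _)
  simp only [CutAt.mk.injEq] at h₁ h₃ h₄
  refine eq_of_rotation fun m => ?_
  fin_cases m
  exacts [by simpa using h₀, h₁, h₂, h₃, h₄]

end CoverStar

theorem IsCyclicStar.exists_coverStar {A : ℤ → ℤ → Prop} [Std.Symm A] {u x w v y : ℤ}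
    (h : IsCyclicStar A u x w v y) : ∃ (S : CoverStar 2) (i : Fin 5), S.EdgesAdj A ∧
      S.z i = u ∧ S.z (i + 2) = w ∧ S.z (i + 3) = v := by
  obtain ⟨hux, hxw, hwv, hvy, huw, huv, hxv, hwy, hxy⟩ := h
  have hvu : A v u := symm (r := A) huv
  have hyx : A y x := symm (r := A) hxy
  have hmono {a b c d e : ℤ} (h : a < b ∧ b < c ∧ c < d ∧ d < e) : StrictMono ![a, b, c, d, e] := by
    simpa using h
  have hedges {a b c d e : ℤ} (h : StrictMono ![a, b, c, d, e]) (hac : A a c) (hbd : A b d)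
      (hce : A c e) (hda : A d a) (heb : A e b) : CoverStar.EdgesAdj A ⟨_, h⟩ := by
    simp [CoverStar.EdgesAdj, Fin.forall_fin_succ, *]
  simp only [CutAt.lt_iff] at hux hxw hwv hvy
  by_cases hy : u ≤ y
  · exact ⟨⟨![u, x, w, v, y], hmono (by lia)⟩, 0, hedges _ huw hxv hwy hvu hyx, rfl, rfl, rfl⟩
  by_cases hv : u ≤ v
  · exact ⟨⟨![y, u, x, w, v], hmono (by lia)⟩, 1, hedges _ hyx huw hxv hwy hvu, rfl, rfl, rfl⟩
  by_cases hw : u ≤ w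
  · exact ⟨⟨![v, y, u, x, w], hmono (by lia)⟩, 2, hedges _ hvu hyx huw hxv hwy, rfl, rfl, rfl⟩
  by_cases hx : u ≤ x
  · exact ⟨⟨![w, v, y, u, x], hmono (by lia)⟩, 3, hedges _ hwy hvu hyx huw hxv, rfl, rfl, rfl⟩
  · exact ⟨⟨![x, w, v, y, u], hmono (by lia)⟩, 4, hedges _ hxv hwy hvu hyx huw, rfl, rfl, rfl⟩

namespace IsPeriodicMaximal

variable {n : ℤ} {A : ℤ → ℤ → Prop} [Std.Symm A] {e : CoverEdge}

theorem existsUnique_upperSide (h : IsPeriodicMaximal n A) (he : A e.lo e.hi)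
    (hlen : e.lo + 2 < e.hi) :
    ∃! x : CoverStar 2 × Fin 2, x.1.EdgesAdj A ∧ x.1.upperSide x.2 = e := by
  obtain ⟨x, w, y, hcyc⟩ := h.exists_isCyclicStar_of_outer he hlen
  obtain ⟨S, j, hS, hlo, -, hhi⟩ := hcyc.exists_coverStar
  have hj : S.z j < S.z (j + 3) := by simpa only [hlo, hhi] using e.lo_lt_hi
  have hpos : ∀ j : Fin 5, j < j + 3 → ∃ i : Fin 2, i.castLE (by decide) = j := by decide
  obtain ⟨i, rfl⟩ := hpos j (S.strictMono.lt_iff_lt.1 hj)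
  refine ⟨(S, i), ⟨hS, CoverEdge.ext hlo hhi⟩, ?_⟩
  rintro ⟨R, m⟩ ⟨hR, rfl⟩
  obtain ⟨rfl, hmi⟩ := hR.eq_of_outer h.noTripleCrossing hS hlo.symm hhi.symm
  exact Prod.ext rfl (Fin.castLE_injective _ hmi)

theorem existsUnique_lowerSide (h : IsPeriodicMaximal n A) (he : A e.lo e.hi)
    (hlen : e.lo + 2 ≤ e.hi) (hne : e.hi ≠ e.lo + 2 * n) :
    ∃! x : CoverStar 2 × Fin 3, x.1.EdgesAdj A ∧ x.1.lowerSide x.2 = e := by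
  obtain ⟨x, v, y, hcyc⟩ := h.exists_isCyclicStar_of_inner he hlen hne
  obtain ⟨S, j, hS, hlo, hhi, -⟩ := hcyc.exists_coverStar
  have hj : S.z j < S.z (j + 2) := by simpa only [hlo, hhi] using e.lo_lt_hi
  have hpos : ∀ j : Fin 5, j < j + 2 → ∃ i : Fin 3, i.castLE (by decide) = j := by decide
  obtain ⟨i, rfl⟩ := hpos j (S.strictMono.lt_iff_lt.1 hj)
  refine ⟨(S, i), ⟨hS, CoverEdge.ext hlo hhi⟩, ?_⟩
  rintro ⟨R, m⟩ ⟨hR, rfl⟩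
  obtain ⟨rfl, hmi⟩ := hR.eq_of_inner h.noTripleCrossing hS hlo.symm hhi.symm
  exact Prod.ext rfl (Fin.castLE_injective _ hmi)

end IsPeriodicMaximal

/-- Two marked points of the cover are joined by an edge in `B`. -/
def Adj (B : Set CoverEdge) (p q : ℤ) : Prop := ∃ e ∈ B, e.Joins p q

section CoverEdge

variable {B : Set CoverEdge} {p q : ℤ}

instance : Std.Symm (Adj B) := ⟨fun _ _ ⟨e, he, hJ⟩ => ⟨e, he, hJ.symm⟩⟩

theorem CoverEdge.Joins.mem (hA : Adj B p q) {e : CoverEdge} (he : e.Joins p q) : e ∈ B := by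
  obtain ⟨f, hf, hJ⟩ := hA
  have hlt_e := e.lo_lt_hi
  have hlt_f := f.lo_lt_hi
  obtain rfl : e = f := by
    unfold CoverEdge.Joins at he hJ
    ext <;> lia
  exact hf

theorem adj_lo_hi_iff {e : CoverEdge} : Adj B e.lo e.hi ↔ e ∈ B :=
  ⟨fun h => CoverEdge.Joins.mem h (.inl ⟨rfl, rfl⟩), fun h => ⟨e, h, .inl ⟨rfl, rfl⟩⟩⟩

theorem adj_iff_of_lt (hpq : p < q) : Adj B p q ↔ ⟨p, q, hpq⟩ ∈ B :=
  adj_lo_hi_iff (e := ⟨p, q, hpq⟩)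

theorem isCrossing_three [DecidableEq CoverEdge] {e f g : CoverEdge} (hef : e.lo < f.lo)
    (hfg : f.lo < g.lo) (hge : g.lo < e.hi) (hef' : e.hi < f.hi) (hfg' : f.hi < g.hi) :
    IsCrossing 3 {e, f, g} := by
  refine ⟨Finset.card_eq_three.2 ⟨e, f, g, ?_, ?_, ?_, rfl⟩, ?_⟩
  iterate 3 (rintro rfl; lia)
  simp only [Finset.coe_insert, Finset.coe_singleton, Set.Pairwise, Set.mem_insert_iff,
    Set.mem_singleton_iff, CoverEdge.Crosses]
  rintro a (rfl | rfl | rfl) b (rfl | rfl | rfl) hab <;> lia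

theorem crossingFree_three_iff : CrossingFree 3 B ↔ NoTripleCrossing (Adj B) := by
  classical
  constructor
  · intro hB a₁ a₂ a₃ b₁ b₂ b₃ ha₁₂ ha₂₃ hab hb₁₂ hb₂₃ e₁ e₂ e₃
    rw [adj_iff_of_lt (by lia)] at e₁ e₂ e₃
    refine hB {⟨a₁, b₁, by lia⟩, ⟨a₂, b₂, by lia⟩, ⟨a₃, b₃, by lia⟩} ?_
      (isCrossing_three ha₁₂ ha₂₃ hab hb₁₂ hb₂₃)
    simp [Set.insert_subset_iff, e₁, e₂, e₃]
  · rintro hB E hE ⟨hcard, hcross⟩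
    obtain ⟨e, f, g, hef, heg, hfg, rfl⟩ := Finset.card_eq_three.1 hcard
    simp only [Finset.coe_insert, Finset.coe_singleton, Set.insert_subset_iff,
      Set.singleton_subset_iff] at hE
    obtain ⟨he, hf, hg⟩ := hE
    have sorted {a b c : CoverEdge} (ha : a ∈ B) (hb : b ∈ B) (hc : c ∈ B)
        (hab : a.lo < b.lo ∧ b.lo < a.hi ∧ a.hi < b.hi)
        (hac : a.lo < c.lo ∧ c.lo < a.hi ∧ a.hi < c.hi)
        (hbc : b.lo < c.lo ∧ c.lo < b.hi ∧ b.hi < c.hi) : False :=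
      hB hab.1 hbc.1 hac.2.1 hab.2.2 hbc.2.2 (adj_lo_hi_iff.2 ha) (adj_lo_hi_iff.2 hb)
        (adj_lo_hi_iff.2 hc)
    rcases hcross (by simp) (by simp) hef with hef | hfe <;>
      rcases hcross (by simp) (by simp) heg with heg | hge <;>
        rcases hcross (by simp) (by simp) hfg with hfg | hgf
    · exact sorted he hf hg hef heg hfg
    · exact sorted he hg hf heg hef hgf
    · lia
    · exact sorted hg he hf hge hgf hef
    · exact sorted hf he hg hfe hfg heg
    · lia
    · exact sorted hf hg he hfg hfe hge
    · exact sorted hg hf he hgf hge hfe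

theorem CoverStar.edges_subset_iff {S : CoverStar 2} : S.edges ⊆ B ↔ S.EdgesAdj (Adj B) := by
  have hmod : ∀ i : Fin 5, Fin.ofNat 5 (i + 2) = i + 2 := by decide
  constructor
  · intro hS i
    have hne : S.z i ≠ S.z (i + 2) := S.strictMono.injective.ne (by decide +revert)
    obtain ⟨e, he⟩ : ∃ e : CoverEdge, e.Joins (S.z i) (S.z (i + 2)) := by
      rcases hne.lt_or_gt with hlt | hlt
      · exact ⟨⟨_, _, hlt⟩, .inl ⟨rfl, rfl⟩⟩
      · exact ⟨⟨_, _, hlt⟩, .inr ⟨rfl, rfl⟩⟩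
    exact ⟨e, hS ⟨i, by rwa [hmod]⟩, he⟩
  · rintro hS e ⟨i, he⟩
    rw [hmod] at he
    exact he.mem (hS i)

end CoverEdge

section Projection

variable {n : ℕ} {T : Set (Edge n)}

theorem projEdge_eq_iff {e f : CoverEdge} :
    projEdge n e = projEdge n f ↔ ∃ l : ℤ, f = e.shift (l * n) :=
  Quotient.eq (r := CoverEdge.translationSetoid n)

theorem projEdge_shift (e : CoverEdge) (l : ℤ) : projEdge n (e.shift (l * n)) = projEdge n e :=
  (projEdge_eq_iff.2 ⟨l, rfl⟩).symm

theorem projStar_eq_iff {k : ℕ} {S R : CoverStar k} :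
    projStar n S = projStar n R ↔ ∃ l : ℤ, R = S.shift (l * n) :=
  Quotient.eq (r := CoverStar.translationSetoid n k)

theorem projStar_shift {k : ℕ} (S : CoverStar k) (l : ℤ) :
    projStar n (S.shift (l * n)) = projStar n S :=
  (projStar_eq_iff.2 ⟨l, rfl⟩).symm

theorem CoverEdge.Joins.shift {e : CoverEdge} {p q : ℤ} (he : e.Joins p q) (t : ℤ) :
    (e.shift t).Joins (p + t) (q + t) := by
  simp only [CoverEdge.Joins, CoverEdge.shift] at he ⊢
  lia

theorem edges_projStar {k : ℕ} (S : CoverStar k) :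
    (projStar n S).edges = projEdge n '' S.edges := by
  refine Set.Subset.antisymm ?_ ?_
  · rintro _ ⟨R, hR, e, ⟨i, he⟩, rfl⟩
    obtain ⟨l, rfl⟩ := projStar_eq_iff.1 hR
    exact ⟨e.shift (l * n), ⟨i, he.shift _⟩, projEdge_shift e l⟩
  · rintro _ ⟨e, he, rfl⟩
    exact ⟨S, rfl, e, he, rfl⟩

theorem edges_projStar_subset_iff {S : CoverStar 2} :
    (projStar n S).edges ⊆ T ↔ S.EdgesAdj (Adj (projEdge n ⁻¹' T)) := by
  rw [edges_projStar, Set.image_subset_iff, CoverStar.edges_subset_iff]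

theorem IsTriangulation.isPeriodicMaximal (hn : 1 ≤ n) (hT : IsTriangulation n 2 T) :
    IsPeriodicMaximal n (Adj (projEdge n ⁻¹' T)) where
  pos := by exact_mod_cast hn
  add_mul := by
    rintro p q l ⟨e, he, hJ⟩
    exact ⟨e.shift (l * n), by rwa [Set.mem_preimage, projEdge_shift], hJ.shift _⟩
  noTripleCrossing := crossingFree_three_iff.1 hT.prop
  maximal := by
    intro p q hpq hA hno
    rw [adj_iff_of_lt hpq] at hA
    refine hA (hT.le_of_ge (y := insert (projEdge n ⟨p, q, hpq⟩) T) ?_ (Set.subset_insert _ _)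
      (Set.mem_insert _ _))
    refine crossingFree_three_iff.2 fun a₁ a₂ a₃ b₁ b₂ b₃ ha₁₂ ha₂₃ hab hb₁₂ hb₂₃ e₁ e₂ e₃ => ?_
    have adj_or_translate {a b : ℤ} (hab : a < b)
        (he : Adj (projEdge n ⁻¹' insert (projEdge n ⟨p, q, hpq⟩) T) a b) :
        Adj (projEdge n ⁻¹' T) a b ∨ ∃ l : ℤ, a = p + l * n ∧ b = q + l * n := by
      rw [adj_iff_of_lt hab] at he ⊢
      refine he.symm.imp_right fun heq => ?_
      obtain ⟨l, hl⟩ := projEdge_eq_iff.1 heq.symm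
      exact ⟨l, congrArg CoverEdge.lo hl, congrArg CoverEdge.hi hl⟩
    exact hno ha₁₂ ha₂₃ hab hb₁₂ hb₂₃ (adj_or_translate (by lia) e₁)
      (adj_or_translate (by lia) e₂) (adj_or_translate (by lia) e₃)

end Projection

section Counting

variable {n : ℕ} {T : Set (Edge n)}

theorem encard_eq_encard_mul {k m : ℕ} {𝒮 : Set (Star n k)} {C : Set (Edge n)}
    (side : CoverStar k → Fin m → CoverEdge)
    (side_shift : ∀ S i t, side (S.shift t) i = (side S i).shift t)
    (side_mem : ∀ S i, projStar n S ∈ 𝒮 → projEdge n (side S i) ∈ C)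
    (existsUnique_side : ∀ e, projEdge n e ∈ C →
      ∃! x : CoverStar k × Fin m, projStar n x.1 ∈ 𝒮 ∧ side x.1 x.2 = e) :
    C.encard = 𝒮.encard * m := by
  let F : Star n k × Fin m → Edge n := fun x =>
    Quotient.lift (s := CoverStar.translationSetoid n k) (fun S => projEdge n (side S x.2))
      (by rintro S _ ⟨l, rfl⟩; exact projEdge_eq_iff.2 ⟨l, side_shift S x.2 _⟩) x.1
  have himage : F '' 𝒮 ×ˢ Set.univ = C := by
    refine Set.Subset.antisymm ?_ fun c hc => ?_
    · rintro _ ⟨⟨⟨S⟩, i⟩, ⟨hS, -⟩, rfl⟩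
      exact side_mem S i hS
    · obtain ⟨e, rfl⟩ := Quotient.exists_rep c
      obtain ⟨⟨S, i⟩, ⟨hS, hSe⟩, -⟩ := existsUnique_side e hc
      exact ⟨(projStar n S, i), ⟨hS, trivial⟩, congrArg (projEdge n) hSe⟩
  have hinj : Set.InjOn F (𝒮 ×ˢ Set.univ) := by
    rintro ⟨⟨S⟩, i⟩ ⟨hS, -⟩ ⟨⟨R⟩, j⟩ ⟨hR, -⟩ heq
    obtain ⟨l, hl⟩ := projEdge_eq_iff.1 heq
    rw [← side_shift] at hl
    replace hS : projStar n (S.shift (l * n)) ∈ 𝒮 := by rwa [projStar_shift]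
    replace hR : projStar n R ∈ 𝒮 := hR
    have hSR := (existsUnique_side _ (side_mem R j hR)).unique (y₁ := (S.shift (l * n), i))
      (y₂ := (R, j)) ⟨hS, hl.symm⟩ ⟨hR, rfl⟩
    rw [Prod.mk.injEq] at hSR
    exact Prod.ext (projStar_eq_iff.2 ⟨l, hSR.1.symm⟩) hSR.2
  rw [← himage, hinj.encard_image, Set.encard_prod, Set.encard_univ, ENat.card_eq_coe_fintype_card,
    Fintype.card_fin]

theorem Edge.length_pos (c : Edge n) : 0 < c.length := by
  obtain ⟨e, rfl⟩ := Quotient.exists_rep c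
  exact sub_pos.2 e.lo_lt_hi

theorem encard_length_eq (hn : 1 ≤ n) {m : ℤ} (hm : 0 < m) :
    {c : Edge n | c.length = m}.encard = n := by
  let F (a : ℤ) : Edge n := projEdge n ⟨a, a + m, by lia⟩
  have himage : F '' (Finset.Ico (0 : ℤ) n : Set ℤ) = {c : Edge n | c.length = m} := by
    refine Set.Subset.antisymm ?_ fun c hc => ?_
    · rintro _ ⟨a, -, rfl⟩
      exact add_sub_cancel_left a m
    · obtain ⟨e, rfl⟩ := Quotient.exists_rep c
      change e.hi - e.lo = m at hc
      have hmod := Int.emod_add_ediv_mul e.lo n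
      refine ⟨e.lo % n, ?_, projEdge_eq_iff.2 ⟨e.lo / n, CoverEdge.ext ?_ ?_⟩⟩
      · rw [Finset.coe_Ico]
        exact ⟨Int.emod_nonneg _ (by lia), Int.emod_lt_of_pos _ (by lia)⟩
      all_goals simp only [CoverEdge.shift]; lia
  have hinj : Set.InjOn F (Finset.Ico (0 : ℤ) n : Set ℤ) := by
    intro a ha b hb hab
    obtain ⟨l, hl⟩ := projEdge_eq_iff.1 hab
    have hba : b = a + l * n := congrArg CoverEdge.lo hl
    rw [Finset.coe_Ico] at ha hb
    rw [← Int.emod_eq_of_lt ha.1 ha.2, ← Int.emod_eq_of_lt hb.1 hb.2, hba,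
      Int.add_mul_emod_self_right]
  rw [← himage, hinj.encard_image, Set.encard_coe_eq_coe_finsetCard, Int.card_Ico, sub_zero,
    Int.toNat_natCast]

/-- The `2`-stars of `C_n` contained in `T`. -/
def starsIn (T : Set (Edge n)) : Set (Star n 2) := {s | s.edges ⊆ T}

theorem projStar_mem_starsIn {S : CoverStar 2} :
    projStar n S ∈ starsIn T ↔ S.EdgesAdj (Adj (projEdge n ⁻¹' T)) :=
  edges_projStar_subset_iff

namespace IsTriangulation

theorem mem_of_length_le_two (hn : 1 ≤ n) (hT : IsTriangulation n 2 T) {c : Edge n}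
    (hc : c.length ≤ 2) : c ∈ T := by
  obtain ⟨e, rfl⟩ := Quotient.exists_rep c
  replace hc : e.hi - e.lo ≤ 2 := hc
  exact adj_lo_hi_iff.1 ((hT.isPeriodicMaximal hn).adj_of_le_add_two e.lo_lt_hi (by lia))

theorem length_le (hn : 1 ≤ n) (hT : IsTriangulation n 2 T) {c : Edge n} (hc : c ∈ T) :
    c.length ≤ 2 * n := by
  obtain ⟨e, rfl⟩ := Quotient.exists_rep c
  exact sub_le_iff_le_add'.2 ((hT.isPeriodicMaximal hn).le_add (adj_lo_hi_iff.2 hc))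

theorem finite (hn : 1 ≤ n) (hT : IsTriangulation n 2 T) : T.Finite := by
  refine Set.Finite.subset ((Set.finite_Ioc (0 : ℤ) (2 * n)).biUnion
    (t := fun m => {c : Edge n | c.length = m}) fun m hm => ?_) fun c hc => ?_
  · exact Set.finite_of_encard_eq_coe (encard_length_eq hn hm.1)
  · exact Set.mem_biUnion ⟨c.length_pos, hT.length_le hn hc⟩ rfl

theorem encard_relevant (hn : 1 ≤ n) (hT : IsTriangulation n 2 T) :
    {c ∈ T | c.IsRelevant 2}.encard = (starsIn T).encard * 2 := by
  have hA := hT.isPeriodicMaximal hn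
  refine encard_eq_encard_mul CoverStar.upperSide (fun _ _ _ => rfl) (fun S i hS => ?_)
    fun e he => ?_
  · have hadj := (projStar_mem_starsIn.1 hS).adj_upperSide i
    exact ⟨adj_lo_hi_iff.1 hadj, S.two_lt_length_upperSide i, sub_le_iff_le_add'.2 (hA.le_add hadj)⟩
  · simp only [projStar_mem_starsIn]
    exact hA.existsUnique_upperSide (adj_lo_hi_iff.2 he.1) (lt_sub_iff_add_lt'.1 he.2.1)

theorem encard_two_le_length_ne (hn : 1 ≤ n) (hT : IsTriangulation n 2 T) :
    {c ∈ T | 2 ≤ c.length ∧ c.length ≠ 2 * n}.encard = (starsIn T).encard * 3 := by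
  have hA := hT.isPeriodicMaximal hn
  refine encard_eq_encard_mul CoverStar.lowerSide (fun _ _ _ => rfl) (fun S i hS => ?_)
    fun e ⟨he, hlen, hne⟩ => ?_
  · replace hS := projStar_mem_starsIn.1 hS
    obtain ⟨j, hj⟩ := S.exists_length_lowerSide_lt i
    have hlen := sub_le_iff_le_add'.2 (hA.le_add (hS.adj_upperSide j))
    exact ⟨adj_lo_hi_iff.1 (hS.adj_lowerSide i), S.two_le_length_lowerSide i, (hj.trans_le hlen).ne⟩
  · simp only [projStar_mem_starsIn]
    exact hA.existsUnique_lowerSide (adj_lo_hi_iff.2 he) (le_sub_iff_add_le'.1 hlen)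
      (by rwa [Ne, ← sub_eq_iff_eq_add'])

theorem encard_length_eq_two_mul (hn : 1 ≤ n) (hT : IsTriangulation n 2 T) :
    {c ∈ T | c.length = 2 * n}.encard = 1 := by
  have hA := hT.isPeriodicMaximal hn
  obtain ⟨a, ha⟩ := hA.exists_isInfiniteStarVertex
  refine Set.encard_eq_one.2 ⟨projEdge n ⟨a, a + 2 * n, by lia⟩,
    Set.eq_singleton_iff_unique_mem.2 ⟨⟨(adj_iff_of_lt _).1 ha, add_sub_cancel_left _ _⟩, ?_⟩⟩
  rintro c ⟨hc, hlen⟩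
  obtain ⟨e, rfl⟩ := Quotient.exists_rep c
  replace hlen : e.hi = e.lo + 2 * n := sub_eq_iff_eq_add'.1 hlen
  have he : IsInfiniteStarVertex n (Adj (projEdge n ⁻¹' T)) e.lo := by
    rw [IsInfiniteStarVertex, ← hlen]
    exact adj_lo_hi_iff.2 hc
  obtain ⟨l, hl⟩ := hA.eq_add_mul_of_isInfiniteStarVertex he ha
  exact projEdge_eq_iff.2 ⟨l, CoverEdge.ext hl (by simp only [CoverEdge.shift]; lia)⟩

theorem encard_two_le_length_eq_mul_two_add (hn : 1 ≤ n) (hT : IsTriangulation n 2 T) :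
    {c ∈ T | 2 ≤ c.length}.encard = (starsIn T).encard * 2 + n := by
  have hunion : {c ∈ T | 2 ≤ c.length} = {c ∈ T | c.IsRelevant 2} ∪ {c | c.length = 2} := by
    ext c
    have hmem := hT.mem_of_length_le_two hn (c := c)
    have hle := hT.length_le hn (c := c)
    simp only [Edge.IsRelevant, Set.mem_union, Set.mem_ofPred_eq]
    grind
  rw [hunion, Set.encard_union_eq, hT.encard_relevant hn, encard_length_eq hn two_pos]
  exact Set.disjoint_left.2 fun c hc heq => hc.2.1.ne' heq

theorem encard_two_le_length_eq_mul_three_add_one (hn : 1 ≤ n) (hT : IsTriangulation n 2 T) :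
    {c ∈ T | 2 ≤ c.length}.encard = (starsIn T).encard * 3 + 1 := by
  have hunion : {c ∈ T | 2 ≤ c.length} =
      {c ∈ T | 2 ≤ c.length ∧ c.length ≠ 2 * n} ∪ {c ∈ T | c.length = 2 * n} := by
    ext c
    simp only [Set.mem_union, Set.mem_ofPred_eq]
    grind
  rw [hunion, Set.encard_union_eq, hT.encard_two_le_length_ne hn, hT.encard_length_eq_two_mul hn]
  exact Set.disjoint_left.2 fun c hc heq => hc.2.2 heq.2

theorem encard_eq (hn : 1 ≤ n) (hT : IsTriangulation n 2 T) :
    T.encard = (starsIn T).encard * 2 + n + n := by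
  have hunion : T = {c ∈ T | 2 ≤ c.length} ∪ {c | c.length = 1} := by
    ext c
    have hmem := hT.mem_of_length_le_two hn (c := c)
    have hpos := c.length_pos
    simp only [Set.mem_union, Set.mem_ofPred_eq]
    grind
  conv_lhs => rw [hunion]
  rw [Set.encard_union_eq, hT.encard_two_le_length_eq_mul_two_add hn, encard_length_eq hn one_pos]
  exact Set.disjoint_left.2 fun c hc heq => (one_lt_two.trans_le hc.2).ne' heq

theorem encard_starsIn (hn : 1 ≤ n) (hT : IsTriangulation n 2 T) :
    (starsIn T).encard = (n - 1 : ℕ) := by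
  have hcount := (hT.encard_two_le_length_eq_mul_three_add_one hn).symm.trans
    (hT.encard_two_le_length_eq_mul_two_add hn)
  have hfinite : (starsIn T).encard ≠ ⊤ := fun htop => by
    have htwo := (hT.finite hn).subset (Set.sep_subset T (Edge.IsRelevant 2))
    rw [← Set.encard_ne_top_iff, hT.encard_relevant hn, htop] at htwo
    exact htwo rfl
  obtain ⟨s, hs⟩ := ENat.ne_top_iff_exists.1 hfinite
  rw [← hs] at hcount ⊢
  norm_cast at hcount ⊢
  lia

end IsTriangulation

end Counting

end HalfCylinder

theorem mainTheorem7 (n : ℕ) (hn : 1 ≤ n) (T : Set (HalfCylinder.Edge n))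
    (hT : HalfCylinder.IsTriangulation n 2 T) :
    {s : HalfCylinder.Star n 2 | s.edges ⊆ T}.encard = ((n - 1 : ℕ) : ℕ∞) ∧
    {c : HalfCylinder.Edge n | c ∈ T ∧ c.IsRelevant 2}.encard = ((2 * (n - 1) : ℕ) : ℕ∞) ∧
    T.encard = ((2 * (2 * n - 1) : ℕ) : ℕ∞) := by
  have hstars := hT.encard_starsIn hn
  refine ⟨hstars, ?_, ?_⟩
  · rw [hT.encard_relevant hn, hstars]
    norm_cast
    lia
  · rw [hT.encard_eq hn, hstars]
    norm_cast
    lia
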